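/- Fix $0<\delta\le 10^{-3}$, a number $n$ of nodes, and $\beta,\epsilon,\lambda$ with $\delta = 20\beta = 5000\,\epsilon\log_2 n$ and $\delta/n^2\le\lambda<\beta$. Let $L$ be the integer with $\beta/2\le 2^L\lambda<\beta$. The input is a simple graph $G=(V,E)$ on $n$ nodes that undergoes edge insertions and deletions and in which, at all times, giving weight $\lambda$ to every edge yields a fractional matching (the weights at each node sum to at most $1$). The algorithm Dynamic-Uniform-Sparsify$(G,\lambda)$ partitions $E$ into active edges $E_a$ and passive edges $E_p$, and keeps for $0\le i\le L$ sets $E^{(\ge i)}, V^{(\ge i)}, F^{(i)}, V^{(i)}$ and a set $D^{(\ge i)}$ of dead edges; its output is $\bigl(V,\bigcup_i F^{(i)}\cap E_a\bigr)$. Rebuild$(j)$: for $i=j,\dots,L-1$, repeatedly remove from $(V^{(\ge i)},E^{(\ge i)})$ a node of current degree at most $1/\epsilon$; let $V^{(i)}$ be the set of removed nodes, $F^{(i)}$ the set of edges of $E^{(\ge i)}$ incident on it, $V^{(\ge i+1)}=V^{(\ge i)}\setminus V^{(i)}$; partition $E^{(\ge i)}\setminus F^{(i)}$ into walks, each maximal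 when it is formed in the graph of the edges not yet used (no unused edge is left at either end of it), let $E^{(\ge i+1)}$ consist of the even numbered edges ($0$th, $2$nd, …) of all the walks, and set $h^{(i+1)}(e)=2h^{(i)}(e)$ for the edges $e$ in it. Finally $F^{(L)}=E^{(\ge L)}$, $V^{(L)}=V^{(\ge L)}$. Static: $V^{(\ge 0)}=V$, $E^{(\ge 0)}=E_a$, $h^{(0)}=\lambda$ on $E_a$, then Rebuild$(0)$. Clean-Up$(j)$: for $i=j,\dots,L$ remove $D^{(\ge i)}$ from $E^{(\ge i)}$ and $F^{(i)}$, and set $D^{(\ge i)}=\emptyset$. Preprocessing: $E_a=E$, $E_p=\emptyset$, all $D^{(\ge i)}=\emptyset$, then Static. Insertion of $e$: add $e$ to $E_p$; if then $|E_p|>\epsilon|E_a|$, call Clean-Up$(0)$, set $E_a\leftarrow E_a\cup E_p$, $E_p\leftarrow\emptyset$, and call Static. Deletion of $e$: if $e\in E_p$, remove it from $E_p$. Otherwise remove it from $E_a$ and add it to $D^{(\ge i)}$ for all $i\le\max\{i: e\in E^{(\ge i)}\}$; if then $|D^{(\ge i)}|>\epsilon|E^{(\ge i)}|$ for some $i$,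 let $j$ be the least such $i$ and call Clean-Up$(j)$ and Rebuild$(j)$. The algorithm is run on a unit-cost random access machine, implemented with adjacency lists, degree counters and a list of the nodes of degree at most $1/\epsilon$; nodes isolated in $E^{(\ge i)}$ are not touched in round $i$, and $V^{(i)}$ is represented through the sets $V^{(\ge i)}$. One unit of time is charged for inserting or erasing an element of a stored set, testing membership, comparing cardinalities (possibly scaled by a real constant), accessing an element, or accessing an array. **Lemma.** The algorithm has amortized update time $O(\epsilon^{-1}\cdot\max\{1,\log_2(\beta/\lambda)\})=O(\log^2 n)$. That is: (1) there is an absolute constant $C$ such that for all parameters as above, every initial graph, every such sequence of $t$ updates, and all ways to make the arbitrary choices in the algorithm, it terminates and the total time spent on the $t$ updates (after the preprocessing) is at most $C\,\epsilon^{-1}\max\{1,\log_2(\beta/\lambda)\}\cdot t$; (2) for every $\delta$ there is a constant $C_\delta$ such that, likewise, this total time is at most $C_\delta\,(\log_2 n)^2\cdot t$. -/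

import Mathlib

open Finset

namespace DynSparsify

/-! ### Programs with a clock

A program is executed on a unit-cost random access machine. `Timed α` is a computation that reads
and advances a clock and, if it terminates, returns a value of type `α`; a computation that does not
terminate has the value `none`.

Finite sets of nodes and of edges are stored as doubly linked lists together with an array of
pointers into the list, and with a counter for the number of elements. Hence to insert or erase one
element, to test membership, to look up the cardinality and to compare it with a given multiple of
another cardinality, and to access some element of a nonempty set, each take one unit of time, as
does one access to an array. -/

abbrev Timed (α : Type) := StateT ℕ Option α

def tick (k : ℕ) : Timed PUnit := modify (· + k)

/-- A loop; each evaluation of the condition costs one unit of time. -/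
def whileDo {σ : Type} (c : σ → Prop) [DecidablePred c] (body : σ → Timed σ) (s : σ) :
    Timed σ := do
  tick 1
  if c s then
    let s' ← body s
    whileDo c body s'
  else
    pure s
  partial_fixpoint

/-- A rule that says which element of a set is met first when the set is accessed. As the choice may
depend on the time of the access (and no two accesses happen at the same time), quantifying over all
rules amounts to quantifying over all ways in which arbitrary choices can be made. -/
structure Chooser (α : Type) where
  choose : ℕ → Finset α → α
  choose_mem : ∀ t s, s.Nonempty → choose t s ∈ s

variable {α σ V : Type} [DecidableEq α] [DecidableEq V]

/-- Access an element of a set: one unit of time. -/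
def pick (o : Chooser α) (S : Finset α) : Timed α := do
  let t ← get
  tick 1
  pure (o.choose t S)

/-- `for all x ∈ S`, in an arbitrary order. -/
def forEach (o : Chooser α) (S : Finset α) (body : α → σ → Timed σ) (s : σ) : Timed σ := do
  let r ← whileDo (fun p : Finset α × σ => p.1.Nonempty)
    (fun p => do
      let x ← pick o p.1
      let s' ← body x p.2
      pure (p.1.erase x, s')) (S, s)
  pure r.2

/-- `old ← new`: the old elements are erased and the new ones inserted, one by one. -/
def overwrite (old new : Finset α) : Timed (Finset α) := do
  tick (#old + #new + 1)
  pure new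

/-- `S ← S ∪ A`, one element of `A` at a time. -/
def addAll (S A : Finset α) : Timed (Finset α) := do
  tick (#A + 1)
  pure (S ∪ A)

/-- `S ← S \ A`, one element of `A` at a time. -/
def removeAll (S A : Finset α) : Timed (Finset α) := do
  tick (#A + 1)
  pure (S \ A)

structure TieBreak (V : Type) where
  node : Chooser V
  edge : Chooser (Sym2 V)

/-! ### Edges and adjacency lists -/

/-- The endpoint of `e` other than `v`. -/
def otherEnd (e : Sym2 V) (v : V) : V :=
  if h : v ∈ e then Sym2.Mem.other' h else v

/-- For every node, the set of its incident edges that are currently present. -/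
abbrev Adj (V : Type) := V → Finset (Sym2 V)

def Adj.insertAt (A : Adj V) (v : V) (e : Sym2 V) : Adj V := Function.update A v (insert e (A v))

def Adj.eraseAt (A : Adj V) (v : V) (e : Sym2 V) : Adj V := Function.update A v ((A v).erase e)

/-! ### Degree-Split -/

/-- The edges with even index `0, 2, 4, …` of a walk. -/
def evenEntries : List α → List α
  | [] => []
  | [a] => [a]
  | a :: _ :: l => a :: evenEntries l

/-- A walk that is being extended at one end: the current end node, the edges of the graph that are
not yet used (as adjacency lists and as a set), and the edges added so far, the last one first. -/
structure WalkEnd (V : Type) where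
  node : V
  adj : Adj V
  rest : Finset (Sym2 V)
  path : List (Sym2 V)

/-- Extend the walk at one end until no unused edge is left at its end node. -/
def extendWalk (o : TieBreak V) (w : WalkEnd V) : Timed (WalkEnd V) :=
  whileDo (fun w : WalkEnd V => (w.adj w.node).Nonempty)
    (fun w => do
      let e ← pick o.edge (w.adj w.node)
      let u := otherEnd e w.node
      tick 4
      pure { node := u
             adj := (w.adj.eraseAt w.node e).eraseAt u e
             rest := w.rest.erase e
             path := e :: w.path }) w

structure SplitState (V : Type) where
  adj : Adj V
  rest : Finset (Sym2 V)
  out : Finset (Sym2 V)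

/-- Partition the edge set `E` (with adjacency lists `adj`) into maximal walks: while edges remain,
start at an endpoint `a` of a remaining edge, extend the walk from `a` as far as possible, and then
extend it at the end `a` as far as possible. Return the even numbered edges of all the walks. -/
def degreeSplit (o : TieBreak V) (adj : Adj V) (E : Finset (Sym2 V)) :
    Timed (Finset (Sym2 V)) := do
  let r ← whileDo (fun s : SplitState V => s.rest.Nonempty)
    (fun s => do
      let e ← pick o.edge s.rest
      let a ← pick o.node e.toFinset
      let fwd ← extendWalk o { node := a, adj := s.adj, rest := s.rest, path := [] }
      let bwd ← extendWalk o { node := a, adj := fwd.adj, rest := fwd.rest, path := [] }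
      let walk := bwd.path ++ fwd.path.reverse
      tick walk.length
      pure { adj := bwd.adj
             rest := bwd.rest
             out := s.out ∪ (evenEntries walk).toFinset }) { adj := adj, rest := E, out := ∅ }
  pure r.out

/-! ### The inner while-loop of Rebuild -/

/-- `low` is a list of nodes that are still present and have degree at most `1 / ε`, `high` consists
of the other nodes that are still present, and `frozen` of the edges that got removed. -/
structure PeelState (V : Type) where
  adj : Adj V
  low : Finset V
  high : Finset V
  frozen : Finset (Sym2 V)

/-- Build the adjacency lists of `E`, and the set of the non-isolated nodes. The array of adjacency
lists is empty beforehand; peeling and splitting use up all its entries, so it is empty again when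
it is next used. -/
def buildAdj (o : TieBreak V) (E : Finset (Sym2 V)) : Timed (Adj V × Finset V) :=
  forEach o.edge E (fun e p =>
    forEach o.node e.toFinset (fun v q => do
      tick 2
      pure (q.1.insertAt v e, insert v q.2)) p) (fun _ => ∅, ∅)

/-- Distribute the nodes to `low` and `high`. -/
noncomputable def classify (o : TieBreak V) (ε : ℝ) (adj : Adj V) (T : Finset V) :
    Timed (PeelState V) :=
  forEach o.node T (fun v s => do
    tick 2
    if (#(adj v) : ℝ) ≤ 1 / ε then
      pure { s with low := insert v s.low }
    else
      pure { s with high := insert v s.high }) { adj := adj, low := ∅, high := ∅, frozen := ∅ }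

/-- While there is a node of degree at most `1 / ε`, remove it together with its incident edges. -/
noncomputable def peelLoop (o : TieBreak V) (ε : ℝ) (s : PeelState V) : Timed (PeelState V) :=
  whileDo (fun s : PeelState V => s.low.Nonempty)
    (fun s => do
      let v ← pick o.node s.low
      tick 1
      forEach o.edge (s.adj v) (fun e s => do
        let u := otherEnd e v
        let adj := (s.adj.eraseAt v e).eraseAt u e
        tick 5
        if u ∈ s.high ∧ (#(adj u) : ℝ) ≤ 1 / ε then
          tick 2
          pure { adj := adj, low := insert u s.low, high := s.high.erase u,
                 frozen := insert e s.frozen }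
        else
          pure { s with adj := adj, frozen := insert e s.frozen })
        { s with low := s.low.erase v }) s

/-- Peel the graph with edge set `E`; at the end, `high` is the set of the remaining nodes and `adj`
holds the adjacency lists of the remaining graph. Isolated nodes, which are always removed, are not
looked at. -/
noncomputable def peel (o : TieBreak V) (ε : ℝ) (E : Finset (Sym2 V)) : Timed (PeelState V) := do
  let (adj, T) ← buildAdj o E
  let s ← classify o ε adj T
  -- empty the temporary set of nodes
  tick #T
  peelLoop o ε s

/-! ### The hierarchy and the algorithm -/

/-- The global variables. The sets `V⁽ⁱ⁾ = V^(≥ i) \ V^(≥ i+1)` for `i < L` and `V⁽ᴸ⁾ = V^(≥ L)` are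
represented through the sets `V^(≥ i)`. -/
structure Hierarchy (V : Type) where
  /-- `E_(a)`, the active edges -/
  Ea : Finset (Sym2 V)
  /-- `E_(p)`, the passive edges -/
  Ep : Finset (Sym2 V)
  /-- `E^(≥ i)` -/
  Ege : ℕ → Finset (Sym2 V)
  /-- `V^(≥ i)` -/
  Vge : ℕ → Finset V
  /-- `F⁽ⁱ⁾` -/
  F : ℕ → Finset (Sym2 V)
  /-- `D^(≥ i)`, the dead edges -/
  D : ℕ → Finset (Sym2 V)
  /-- the weights `h⁽ⁱ⁾` -/
  h : ℕ → Sym2 V → ℝ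
  /-- `F_(a) = (⋃ᵢ F⁽ⁱ⁾) ∩ E_(a)`, the edges of the sparsifier -/
  Fa : Finset (Sym2 V)

/-- Everything is empty, and `V^(≥ 0) = V`. -/
def Hierarchy.initial (V : Type) [Fintype V] : Hierarchy V where
  Ea := ∅
  Ep := ∅
  Ege := fun _ => ∅
  Vge := fun i => if i = 0 then Finset.univ else ∅
  F := fun _ => ∅
  D := fun _ => ∅
  h := fun _ _ => 0
  Fa := ∅

/-- `F⁽ⁱ⁾ ← X`, and `X` is added to the sparsifier. -/
def setF (i : ℕ) (X : Finset (Sym2 V)) (s : Hierarchy V) : Timed (Hierarchy V) := do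
  let X' ← overwrite (s.F i) X
  let Fa' ← addAll s.Fa X
  pure { s with F := Function.update s.F i X', Fa := Fa' }

/-- Iteration `i` of the outer loop of Rebuild. -/
noncomputable def rebuildLevel (o : TieBreak V) (ε : ℝ) (s : Hierarchy V) (i : ℕ) :
    Timed (Hierarchy V) := do
  let p ← peel o ε (s.Ege i)
  let Vnext ← overwrite (s.Vge (i + 1)) p.high
  let s₁ ← setF i p.frozen s
  let E₀ ← overwrite ∅ (s.Ege i)
  let E' ← removeAll E₀ p.frozen
  let X ← degreeSplit o p.adj E'
  let Enext ← overwrite (s.Ege (i + 1)) X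
  -- double the weights, and empty the temporary sets
  tick #Enext
  tick (#p.high + #p.frozen + #X)
  pure { s₁ with
         Vge := Function.update s₁.Vge (i + 1) Vnext
         Ege := Function.update s₁.Ege (i + 1) Enext
         h := Function.update s₁.h (i + 1)
           (fun e => if e ∈ Enext then 2 * s₁.h i e else s₁.h (i + 1) e) }

/-- Rebuild`(j, λ)`: the old sets `F⁽ʲ⁾, …, F⁽ᴸ⁾` are taken out of the sparsifier, the levels
`j, …, L - 1` are rebuilt, and then `F⁽ᴸ⁾ ← E^(≥ L)`. -/
noncomputable def rebuild (o : TieBreak V) (ε : ℝ) (L j : ℕ) (s : Hierarchy V) :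
    Timed (Hierarchy V) := do
  let Fa' ← (List.range' j (L + 1 - j)).foldlM (fun Fa i => removeAll Fa (s.F i)) s.Fa
  let s' ← (List.range' j (L - j)).foldlM (rebuildLevel o ε) { s with Fa := Fa' }
  setF L (s'.Ege L) s'

/-- Static-Uniform-Sparsify, for the active subgraph. -/
noncomputable def staticSparsify (o : TieBreak V) (ε lam : ℝ) (L : ℕ) (s : Hierarchy V) :
    Timed (Hierarchy V) := do
  let E₀ ← overwrite (s.Ege 0) s.Ea
  tick (#E₀ + 1)
  rebuild o ε L 0
    { s with
      Ege := Function.update s.Ege 0 E₀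
      h := Function.update s.h 0 (fun e => if e ∈ E₀ then lam else s.h 0 e) }

/-- Clean-Up`(j, λ)`: remove the dead edges from the levels `j, …, L`. -/
def cleanUp (L j : ℕ) (s : Hierarchy V) : Timed (Hierarchy V) :=
  (List.range' j (L + 1 - j)).foldlM (fun s i => do
    let E' ← removeAll (s.Ege i) (s.D i)
    let F' ← removeAll (s.F i) (s.D i)
    let D' ← overwrite (s.D i) ∅
    pure { s with
           Ege := Function.update s.Ege i E'
           F := Function.update s.F i F'
           D := Function.update s.D i D' }) s

noncomputable def handleInsertion (o : TieBreak V) (ε lam : ℝ) (L : ℕ) (e : Sym2 V)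
    (s : Hierarchy V) : Timed (Hierarchy V) := do
  tick 2
  let s : Hierarchy V := { s with Ep := insert e s.Ep }
  if (#s.Ep : ℝ) > ε * (#s.Ea : ℝ) then
    let s ← cleanUp L 0 s
    let Ea' ← addAll s.Ea s.Ep
    let Ep' ← overwrite s.Ep ∅
    staticSparsify o ε lam L { s with Ea := Ea', Ep := Ep' }
  else
    pure s

noncomputable def handleDeletion (o : TieBreak V) (ε : ℝ) (L : ℕ) (e : Sym2 V)
    (s : Hierarchy V) : Timed (Hierarchy V) := do
  tick 1
  if e ∈ s.Ep then
    tick 1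
    pure { s with Ep := s.Ep.erase e }
  else
    -- the level of `e`, from the membership tests on all the levels
    tick (L + 1)
    let k := ((Finset.range (L + 1)).filter (fun i => e ∈ s.Ege i)).sup id
    -- `e` is erased from `E_(a)` and `F_(a)` and inserted into `D^(≥ 0), …, D^(≥ k)`
    tick (2 + (k + 1))
    let s : Hierarchy V :=
      { s with
        Ea := s.Ea.erase e
        Fa := s.Fa.erase e
        D := fun i => if i ≤ k then insert e (s.D i) else s.D i }
    -- the least level, if any, with too many dead edges
    tick (L + 1)
    match (List.range (L + 1)).find? (fun i => decide ((#(s.D i) : ℝ) > ε * (#(s.Ege i) : ℝ))) with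
    | none => pure s
    | some j =>
      let s ← cleanUp L j s
      rebuild o ε L j s

/-- The preprocessing step, for the initial edge set `E`. -/
noncomputable def preprocess (V : Type) [Fintype V] [DecidableEq V] (o : TieBreak V) (ε lam : ℝ)
    (L : ℕ) (E : Finset (Sym2 V)) : Timed (Hierarchy V) := do
  let Ea' ← overwrite ∅ E
  staticSparsify o ε lam L { Hierarchy.initial V with Ea := Ea' }

/-! ### Update sequences and amortized update time -/

inductive Update (V : Type) where
  | insertion (e : Sym2 V)
  | deletion (e : Sym2 V)

def Update.apply (E : Finset (Sym2 V)) : Update V → Finset (Sym2 V)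
  | .insertion e => insert e E
  | .deletion e => E.erase e

/-- An edge is inserted only if it is absent (and is not a loop), and deleted only if present. -/
def Update.Legal (E : Finset (Sym2 V)) : Update V → Prop
  | .insertion e => ¬ e.IsDiag ∧ e ∉ E
  | .deletion e => e ∈ E

/-- The weights `w(e) = lam` on the edges in `E` form a fractional matching. -/
def IsUniformMatching (lam : ℝ) (E : Finset (Sym2 V)) : Prop :=
  ∀ v : V, ∑ _e ∈ E.filter (fun e => v ∈ e), lam ≤ 1

/-- The sequence consists of legal updates, starting from the simple graph with edge set `E`, and
the graph admits a `lam`-uniform fractional matching throughout. -/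
def ValidSequence (lam : ℝ) : Finset (Sym2 V) → List (Update V) → Prop
  | E, [] => IsUniformMatching lam E
  | E, u :: us => IsUniformMatching lam E ∧ u.Legal E ∧ ValidSequence lam (u.apply E) us

noncomputable def handleUpdate (o : TieBreak V) (ε lam : ℝ) (L : ℕ) (s : Hierarchy V) :
    Update V → Timed (Hierarchy V)
  | .insertion e => handleInsertion o ε lam L e s
  | .deletion e => handleDeletion o ε L e s

/-- The largest integer `k` with `β / 2 ≤ 2 ^ k * lam < β`. -/
noncomputable def numLevels (β lam : ℝ) : ℕ :=
  sSup {k : ℕ | β / 2 ≤ 2 ^ k * lam ∧ 2 ^ k * lam < β}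

/-- Run Dynamic-Uniform-Sparsify on the initial graph with edge set `E` and the updates `us`, and
return the time that passes between the end of the preprocessing and the end of the last update. -/
noncomputable def totalUpdateTime (V : Type) [Fintype V] [DecidableEq V] (o : TieBreak V)
    (β ε lam : ℝ) (E : Finset (Sym2 V)) (us : List (Update V)) : Timed ℕ := do
  let s ← preprocess V o ε lam (numLevels β lam) E
  let t₀ ← get
  let _ ← us.foldlM (handleUpdate o ε lam (numLevels β lam)) s
  let t₁ ← get
  pure (t₁ - t₀)

/-- However the arbitrary choices are made, Dynamic-Uniform-Sparsify terminates on each valid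
input, and it handles every sequence of updates in time at most `B` times the number of updates. -/
def HasAmortizedUpdateTime (V : Type) [Fintype V] [DecidableEq V] (β ε lam B : ℝ) : Prop :=
  ∀ (o : TieBreak V) (E : Finset (Sym2 V)) (us : List (Update V)),
    (∀ e ∈ E, ¬ e.IsDiag) → ValidSequence lam E us →
      ∃ T : ℕ, (totalUpdateTime V o β ε lam E us).run' 0 = some T ∧ (T : ℝ) ≤ B * us.length

/-- The standing assumptions on the parameters, for graphs on `n` nodes. -/
structure Parameters (n : ℕ) (δ β ε lam : ℝ) : Prop where
  δ_pos : 0 < δ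
  δ_le : δ ≤ 1 / 1000
  δ_eq_β : δ = 20 * β
  δ_eq_ε : δ = 5000 * ε * Real.logb 2 n
  le_lam : δ / n ^ 2 ≤ lam
  lam_lt : lam < β

end DynSparsify

/-!
The running time is bounded by an amortized analysis with the potential `600 / ε` times the number
of passive edges plus the number of pairs of a level and an edge that is dead on it (`numPending`).
It vanishes after the preprocessing, and an update raises it by at most `600 (L + 1) / ε` before the
structure is repaired.

* One round of Rebuild takes time linear in the size of `E^(≥ i)` and in the sizes of the sets that
  it overwrites. For the peeling, every node is removed once and every edge is frozen once
  (`spec_peelLoop`); for the splitting, every edge is used once (`spec_degreeSplit`).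
* The sizes of the sets `E^(≥ i)` decay geometrically. A walk of odd length contributes half an edge
  more than half of its length, and each walk exhausts the node where it stops, so there are at most
  as many walks as remaining nodes. After the peeling all these nodes have degree greater than
  `1 / ε ≥ 4`, so there are at most half as many of them as edges (`spec_peel`). Together,
  `4 |E^(≥ i+1)| ≤ 3 |E^(≥ i)|`, which is part of the invariant `LevelInv`. Hence the first level
  dominates both the sizes of the new sets and those of the old ones, and Rebuild from level `j`
  takes time `O(|E^(≥ j)| + L + 1)` (`spec_rebuild`).
* After a deletion, Rebuild from level `j` happens only if `|E^(≥ j)| < |D^(≥ j)| / ε`, and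
  `D^(≥ j)` is emptied, so the drop of the potential pays (`spec_handleDeletion`). After an
  insertion, Static happens only if `|E_a| < |E_p| / ε`, and `E^(≥ 0) ⊆ E_a ∪ D^(≥ 0)`, so the
  passive and dead edges, which all disappear, pay (`spec_handleInsertion`).

Finally `L ≤ log₂ (β / λ)`, and `β / λ ≤ n²`.
-/

namespace DynSparsify

/-! ### A program logic for timed computations -/

/-- `Spec m Q`: started at any time, `m` terminates, and its result `a` and the time `k` that it
takes satisfy `Q a k`. -/
def Spec {α : Type} (m : Timed α) (Q : α → ℕ → Prop) : Prop :=
  ∀ t, ∃ a k, m.run t = some (a, t + k) ∧ Q a k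

namespace Spec

variable {α β σ : Type}

theorem mono {m : Timed α} {P Q : α → ℕ → Prop} (hm : Spec m P) (h : ∀ a k, P a k → Q a k) :
    Spec m Q := fun t =>
  let ⟨a, k, h₁, h₂⟩ := hm t
  ⟨a, k, h₁, h a k h₂⟩

theorem pure {a : α} {Q : α → ℕ → Prop} (h : Q a 0) : Spec (Pure.pure a) Q :=
  fun _ => ⟨a, 0, rfl, h⟩

theorem bind {m : Timed α} {f : α → Timed β} {P : α → ℕ → Prop} {Q : β → ℕ → Prop}
    (hm : Spec m P) (hf : ∀ a k, P a k → Spec (f a) fun b k' => Q b (k + k')) :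
    Spec (m >>= f) Q := fun t => by
  obtain ⟨a, k, h₁, h₂⟩ := hm t
  obtain ⟨b, k', h₃, h₄⟩ := hf a k h₂ (t + k)
  exact ⟨b, k + k', by rw [StateT.run_bind, h₁, ← add_assoc]; exact h₃, h₄⟩

theorem tick_bind {n : ℕ} {f : PUnit → Timed β} {Q : β → ℕ → Prop}
    (h : Spec (f ⟨⟩) fun b k => Q b (n + k)) : Spec (tick n >>= f) Q :=
  bind (P := fun _ k => k = n) (fun _ => ⟨⟨⟩, n, rfl, rfl⟩) (by rintro _ _ rfl; exact h)

theorem tick_pure {n : ℕ} {a : α} {Q : α → ℕ → Prop} (h : Q a n) :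
    Spec (tick n >>= fun _ => Pure.pure a) Q :=
  tick_bind (pure h)

/-- As every evaluation of the condition takes time, a potential that pays for the iterations also
shows that the loop terminates. -/
theorem whileDo {c : σ → Prop} [DecidablePred c] {body : σ → Timed σ} (Inv : σ → Prop)
    (φ : σ → ℕ)
    (h : ∀ s, Inv s → c s → Spec (body s) fun s' k => Inv s' ∧ k + 1 + φ s' ≤ φ s)
    {s : σ} (hs : Inv s) :
    Spec (whileDo c body s) fun s' k => Inv s' ∧ ¬ c s' ∧ k + φ s' ≤ φ s + 1 := by
  induction hn : φ s using Nat.strong_induction_on generalizing s with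
  | _ n ih =>
    subst hn
    rw [DynSparsify.whileDo]
    refine tick_bind ?_
    split_ifs with hc
    · refine bind (h s hs hc) fun s' k hk => ?_
      refine (ih (φ s') (by omega) hk.1 rfl).mono fun s'' k' hk' => ⟨hk'.1, hk'.2.1, ?_⟩
      omega
    · exact pure ⟨hs, hc, by omega⟩

theorem pick [DecidableEq α] (o : Chooser α) {S : Finset α} (hS : S.Nonempty) :
    Spec (pick o S) fun x k => x ∈ S ∧ k = 1 :=
  fun t => ⟨o.choose t S, 1, rfl, o.choose_mem t S hS, rfl⟩

/-- The invariant of a `forEach` loop depends on the set `R` of the elements still to come. -/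
theorem forEach [DecidableEq α] (o : Chooser α) {S : Finset α} {body : α → σ → Timed σ}
    (Inv : Finset α → σ → Prop) (c : ℕ)
    (h : ∀ R ⊆ S, ∀ x ∈ R, ∀ s, Inv R s →
      Spec (body x s) fun s' k => Inv (R.erase x) s' ∧ k ≤ c)
    {s : σ} (hs : Inv S s) :
    Spec (forEach o S body s) fun s' k => Inv ∅ s' ∧ k ≤ (c + 2) * #S + 1 := by
  refine bind (whileDo (fun p : Finset α × σ => p.1 ⊆ S ∧ Inv p.1 p.2)
    (fun p => (c + 2) * #p.1) ?_ ⟨subset_rfl, hs⟩) ?_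
  · rintro ⟨R, s⟩ ⟨hR, hI⟩ hne
    refine bind (pick o hne) fun x k hx => ?_
    refine bind (h R hR x hx.1 s hI) fun s' k' hk => pure ?_
    refine ⟨⟨(erase_subset _ _).trans hR, hk.1⟩, ?_⟩
    have := card_erase_add_one hx.1
    dsimp only at this ⊢
    rw [← this]
    have := hx.2
    have := hk.2
    rw [mul_add]
    omega
  · rintro ⟨R, s⟩ k ⟨⟨-, hI⟩, hR, hk⟩
    obtain rfl : R = ∅ := not_nonempty_iff_eq_empty.1 hR
    exact pure ⟨hI, by simpa using hk⟩

theorem overwrite [DecidableEq α] (S T : Finset α) :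
    Spec (overwrite S T) fun X k => X = T ∧ k = #S + #T + 1 := tick_pure ⟨rfl, rfl⟩

theorem addAll [DecidableEq α] (S A : Finset α) :
    Spec (addAll S A) fun X k => X = S ∪ A ∧ k = #A + 1 := tick_pure ⟨rfl, rfl⟩

theorem removeAll [DecidableEq α] (S A : Finset α) :
    Spec (removeAll S A) fun X k => X = S \ A ∧ k = #A + 1 := tick_pure ⟨rfl, rfl⟩

end Spec

variable {V : Type} [DecidableEq V]

/-! ### Adjacency lists -/

theorem mem_insertAt {A : Adj V} {v x : V} {e f : Sym2 V} :
    f ∈ A.insertAt v e x ↔ f ∈ A x ∨ x = v ∧ f = e := by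
  unfold Adj.insertAt
  by_cases h : x = v
  · subst h; simp [or_comm]
  · simp [h]

theorem mem_eraseAt {A : Adj V} {v x : V} {e f : Sym2 V} :
    f ∈ A.eraseAt v e x ↔ f ∈ A x ∧ ¬(x = v ∧ f = e) := by
  unfold Adj.eraseAt
  by_cases h : x = v
  · subst h; simp [and_comm]
  · simp [h]

theorem otherEnd_mem {e : Sym2 V} {v : V} (h : v ∈ e) : otherEnd e v ∈ e := by
  rw [otherEnd, dif_pos h]
  exact Sym2.other_mem' h

theorem eq_or_eq_otherEnd {e : Sym2 V} {v x : V} (h : v ∈ e) (hx : x ∈ e) :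
    x = v ∨ x = otherEnd e v := by
  rw [otherEnd, dif_pos h]
  rw [← Sym2.other_spec' h] at hx
  exact Sym2.mem_iff.1 hx

/-- `A` holds the adjacency lists of the graph with edge set `E`. -/
def IsAdj (A : Adj V) (E : Finset (Sym2 V)) : Prop := ∀ v e, e ∈ A v ↔ e ∈ E ∧ v ∈ e

theorem IsAdj.erase {A : Adj V} {E : Finset (Sym2 V)} (h : IsAdj A E) {e : Sym2 V} {v : V}
    (hv : v ∈ e) : IsAdj ((A.eraseAt v e).eraseAt (otherEnd e v) e) (E.erase e) := by
  intro x f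
  rw [mem_eraseAt, mem_eraseAt, h x f, mem_erase]
  by_cases hf : f = e
  · subst hf
    have := @eq_or_eq_otherEnd _ _ f v x hv
    tauto
  · simp [hf]

theorem card_toFinset_le_two (e : Sym2 V) : #e.toFinset ≤ 2 := by
  rw [Sym2.card_toFinset]
  split_ifs <;> omega

theorem IsAdj.sum_card_le {A : Adj V} {E : Finset (Sym2 V)} (h : IsAdj A E) (H : Finset V) :
    ∑ v ∈ H, #(A v) ≤ 2 * #E := by
  have hA : ∀ v, A v = E.bipartiteAbove (fun v e => v ∈ e) v := fun v => by
    ext e; simp [h v e, bipartiteAbove]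
  simp_rw [hA]
  rw [sum_card_bipartiteAbove_eq_sum_card_bipartiteBelow, mul_comm]
  refine sum_le_card_nsmul _ _ _ fun e _ => (card_le_card fun v hv => ?_).trans
    (card_toFinset_le_two e)
  simpa using (mem_filter.1 hv).2

/-! ### Degree-Split -/

theorem two_mul_length_evenEntries_le {α : Type} (l : List α) :
    2 * (evenEntries l).length ≤ l.length + 1 := by
  induction l using evenEntries.induct with
  | case1 => simp [evenEntries]
  | case2 => simp [evenEntries]
  | case3 a b l ih => simp only [evenEntries, List.length_cons]; omega

/-- Here `E₀` is the set of the edges that were unused when the walk was begun: the node at which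
the extension stops lies on one of them, but on no edge that is unused in the end. -/
theorem spec_extendWalk (o : TieBreak V) (E₀ : Finset (Sym2 V)) {w : WalkEnd V}
    (hw : IsAdj w.adj w.rest) (hsub : w.rest ⊆ E₀) (hnode : ∃ e ∈ E₀, w.node ∈ e) :
    Spec (extendWalk o w) fun w' k =>
      IsAdj w'.adj w'.rest ∧ w'.rest ⊆ w.rest ∧ (∃ e ∈ E₀, w'.node ∈ e) ∧
        w'.path.length + #w'.rest = w.path.length + #w.rest ∧ w'.adj w'.node = ∅ ∧
        k + 6 * #w'.rest ≤ 6 * #w.rest + 1 := by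
  refine (Spec.whileDo (fun w' : WalkEnd V => IsAdj w'.adj w'.rest ∧ w'.rest ⊆ w.rest ∧
    (∃ e ∈ E₀, w'.node ∈ e) ∧ w'.path.length + #w'.rest = w.path.length + #w.rest)
    (fun w' => 6 * #w'.rest) ?_ ⟨hw, subset_rfl, hnode, rfl⟩).mono ?_
  · rintro w' ⟨hA, hs, -, hl⟩ hne
    refine Spec.bind (Spec.pick o.edge hne) fun e k he => Spec.tick_pure ?_
    obtain ⟨heA, rfl⟩ := he
    obtain ⟨her, hv⟩ := (hA _ _).1 heA
    have := card_erase_add_one her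
    refine ⟨⟨hA.erase hv, (erase_subset _ _).trans hs, ⟨e, hsub (hs her), otherEnd_mem hv⟩, ?_⟩,
      ?_⟩
    · simp only [List.length_cons]; omega
    · dsimp only; omega
  · rintro w' k ⟨⟨h₁, h₂, h₃, h₄⟩, h₅, h₆⟩
    exact ⟨h₁, h₂, h₃, h₄, not_nonempty_iff_eq_empty.1 h₅, h₆⟩

/-- Every walk uses up the edges at the node where it stops, hence there are at most `#H` walks, and
each of them contributes at most half an edge beyond half of its length. -/
theorem spec_degreeSplit (o : TieBreak V) {adj : Adj V} {E : Finset (Sym2 V)} (hA : IsAdj adj E)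
    {H : Finset V} (hH : ∀ v, (adj v).Nonempty → v ∈ H) :
    Spec (degreeSplit o adj E) fun X k =>
      2 * #X ≤ #E + #H ∧ k ≤ 7 * #E + 5 * #H + 1 := by
  set act : SplitState V → Finset V := fun s => H.filter fun v => (s.adj v).Nonempty with hact
  refine Spec.bind (Spec.whileDo (fun s : SplitState V => IsAdj s.adj s.rest ∧ s.rest ⊆ E ∧
    2 * #s.out + #s.rest + #(act s) ≤ #E + #H) (fun s => 7 * #s.rest + 5 * #(act s)) ?_
    ⟨hA, subset_rfl, ?_⟩) ?_
  · rintro s ⟨hs, hsE, hcard⟩ hne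
    refine Spec.bind (Spec.pick o.edge hne) fun e k he => ?_
    obtain ⟨he, rfl⟩ := he
    have hene : e.toFinset.Nonempty := ⟨e.out.1, by simpa using Sym2.out_fst_mem e⟩
    refine Spec.bind (Spec.pick o.node hene) fun a k ha => ?_
    obtain ⟨ha, rfl⟩ := ha
    rw [Sym2.mem_toFinset] at ha
    refine Spec.bind (spec_extendWalk o s.rest (w := ⟨a, s.adj, s.rest, []⟩) hs subset_rfl
      ⟨e, he, ha⟩) fun fwd k₁ hf => ?_
    obtain ⟨hf₁, hf₂, -, hf₄, -, hf₆⟩ := hf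
    refine Spec.bind (spec_extendWalk o s.rest (w := ⟨a, fwd.adj, fwd.rest, []⟩) hf₁ hf₂
      ⟨e, he, ha⟩) fun bwd k₂ hb => ?_
    obtain ⟨hb₁, hb₂, ⟨f, hf, hfb⟩, hb₄, hb₅, hb₆⟩ := hb
    refine Spec.tick_pure ?_
    dsimp only at hf₂ hf₄ hf₆ hb₂ hb₄ hb₆
    set walk := bwd.path ++ fwd.path.reverse with hwalk
    have hlen : walk.length = bwd.path.length + fwd.path.length := by simp [hwalk]
    set s' : SplitState V := ⟨bwd.adj, bwd.rest, s.out ∪ (evenEntries walk).toFinset⟩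
    have hsub : act s' ⊂ act s := by
      refine (ssubset_iff_of_subset fun v hv => ?_).2 ⟨bwd.node, ?_, ?_⟩
      · obtain ⟨hvH, g, hg⟩ := mem_filter.1 hv
        obtain ⟨hg₁, hg₂⟩ := (hb₁ _ _).1 hg
        exact mem_filter.2 ⟨hvH, g, (hs _ _).2 ⟨hf₂ (hb₂ hg₁), hg₂⟩⟩
      · exact mem_filter.2 ⟨hH _ ⟨f, (hA _ _).2 ⟨hsE hf, hfb⟩⟩, f, (hs _ _).2 ⟨hf, hfb⟩⟩
      · simp [hact, s', hb₅]
    have hlt := card_lt_card hsub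
    have hout : #s'.out ≤ #s.out + (evenEntries walk).length :=
      (card_union_le _ _).trans (Nat.add_le_add_left (List.toFinset_card_le _) _)
    have heven := two_mul_length_evenEntries_le walk
    have hrest : s'.rest = bwd.rest := rfl
    simp only [List.length_nil] at hf₄ hb₄
    refine ⟨⟨hb₁, (hb₂.trans hf₂).trans hsE, ?_⟩, ?_⟩
    · rw [hrest]; omega
    · rw [hrest]; omega
  · have : #(act ⟨adj, E, ∅⟩) ≤ #H := card_filter_le _ _
    simp only [card_empty]
    omega
  · rintro s k ⟨⟨-, -, h⟩, -, hk⟩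
    have : #(act ⟨adj, E, ∅⟩) ≤ #H := card_filter_le _ _
    refine Spec.pure ⟨by omega, ?_⟩
    dsimp only at hk
    omega

/-! ### Peeling -/

theorem spec_buildAdj (o : TieBreak V) (E : Finset (Sym2 V)) :
    Spec (buildAdj o E) fun p k =>
      IsAdj p.1 E ∧ p.2 = E.biUnion Sym2.toFinset ∧ k ≤ 11 * #E + 1 := by
  refine (Spec.forEach o.edge (fun R p => IsAdj p.1 (E \ R) ∧
    p.2 = (E \ R).biUnion Sym2.toFinset) 9 ?_ ?_).mono ?_
  · rintro R hR e he ⟨A, T⟩ ⟨hA, hT⟩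
    have hER : E \ R.erase e = insert e (E \ R) := by
      ext f
      simp only [mem_sdiff, mem_erase, mem_insert]
      have := @hR e he
      by_cases hf : f = e
      · subst hf; tauto
      · tauto
    dsimp only at hT hA
    refine (Spec.forEach o.node (fun R' q =>
      (∀ v f, f ∈ q.1 v ↔ f ∈ A v ∨ f = e ∧ v ∈ e.toFinset \ R') ∧
        q.2 = T ∪ (e.toFinset \ R')) 2 ?_ ?_).mono ?_
    · rintro R' hR' v hv ⟨A', T'⟩ ⟨hA', hT'⟩
      have hv' : e.toFinset \ R'.erase v = insert v (e.toFinset \ R') := by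
        ext x
        simp only [mem_sdiff, mem_erase, mem_insert]
        have := @hR' v hv
        by_cases hx : x = v
        · subst hx; tauto
        · tauto
      refine Spec.tick_pure ⟨⟨fun x f => ?_, ?_⟩, le_rfl⟩
      · rw [hv', mem_insertAt, hA', mem_insert]
        tauto
      · dsimp only at hT' ⊢
        rw [hv', hT', union_insert]
    · simp
    · rintro ⟨A', T'⟩ k ⟨⟨hA', hT'⟩, hk⟩
      dsimp only at hA' hT'
      refine ⟨⟨fun v f => ?_, ?_⟩, ?_⟩
      · simp only [hER, mem_insert, hA', hA v f, sdiff_empty, Sym2.mem_toFinset]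
        by_cases hf : f = e
        · subst hf; tauto
        · tauto
      · rw [hER, hT', hT, biUnion_insert, sdiff_empty, union_comm]
      · have := card_toFinset_le_two e
        omega
  · refine ⟨fun v e => by simp, by simp⟩
  · rintro p k ⟨⟨hA, hT⟩, hk⟩
    rw [sdiff_empty] at hA hT
    exact ⟨hA, hT, by omega⟩

/-- What the peeling maintains for the graph with edge set `E`: the nodes that are not isolated,
with the possible exception of those in `X`, are `low` or `high`, and the latter have degree greater
than `1 / ε`. -/
structure PeelInv (ε : ℝ) (E : Finset (Sym2 V)) (X : Set V) (s : PeelState V) : Prop where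
  isAdj : IsAdj s.adj (E \ s.frozen)
  frozen_subset : s.frozen ⊆ E
  disjoint : Disjoint s.low s.high
  degree : ∀ v ∈ s.high, ¬ (#(s.adj v) : ℝ) ≤ 1 / ε
  mem : ∀ v ∉ X, (s.adj v).Nonempty → v ∈ s.low ∨ v ∈ s.high

theorem spec_classify (o : TieBreak V) (ε : ℝ) {E : Finset (Sym2 V)} {adj : Adj V}
    (hA : IsAdj adj E) :
    Spec (classify o ε adj (E.biUnion Sym2.toFinset)) fun s k =>
      PeelInv ε E ∅ s ∧ s.frozen = ∅ ∧ #s.low + #s.high ≤ 2 * #E ∧ k ≤ 8 * #E + 1 := by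
  set T := E.biUnion Sym2.toFinset with hT
  have hTcard : #T ≤ #E * 2 := card_biUnion_le_card_mul _ _ _ fun e _ => card_toFinset_le_two e
  refine (Spec.forEach o.node (fun R s => s.adj = adj ∧ s.frozen = ∅ ∧ Disjoint s.low s.high ∧
    s.low ∪ s.high = T \ R ∧ ∀ v ∈ s.high, ¬ (#(adj v) : ℝ) ≤ 1 / ε) 2 ?_ ?_).mono ?_
  · rintro R hR v hv s ⟨h₁, h₂, h₃, h₄, h₅⟩
    have hTR : T \ R.erase v = insert v (T \ R) := by
      ext x
      simp only [mem_sdiff, mem_erase, mem_insert]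
      have := @hR v hv
      by_cases hx : x = v
      · subst hx; tauto
      · tauto
    have hnot : v ∉ s.low ∪ s.high := by rw [h₄]; simp [hv]
    rw [notMem_union] at hnot
    refine Spec.tick_bind ?_
    split_ifs with hdeg
    · refine Spec.pure ⟨⟨h₁, h₂, ?_, ?_, h₅⟩, le_rfl⟩
      · exact disjoint_insert_left.2 ⟨hnot.2, h₃⟩
      · rw [hTR, ← h₄, insert_union]
    · refine Spec.pure ⟨⟨h₁, h₂, ?_, ?_, ?_⟩, le_rfl⟩
      · exact disjoint_insert_right.2 ⟨hnot.1, h₃⟩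
      · rw [hTR, ← h₄, union_insert]
      · intro x hx
        rcases mem_insert.1 hx with rfl | hx
        · exact hdeg
        · exact h₅ x hx
  · simp
  · rintro s k ⟨⟨h₁, h₂, h₃, h₄, h₅⟩, hk⟩
    rw [sdiff_empty] at h₄
    refine ⟨⟨by rw [h₁, h₂, sdiff_empty]; exact hA, by simp [h₂], h₃, by rwa [h₁], ?_⟩, h₂, ?_, ?_⟩
    · rintro v - ⟨e, he⟩
      rw [h₁] at he
      rw [← mem_union, h₄, hT, mem_biUnion]
      exact ⟨e, ((hA _ _).1 he).1, by simpa using ((hA _ _).1 he).2⟩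
    · rw [← card_union_of_disjoint h₃, h₄]
      omega
    · omega

theorem spec_peelLoop (o : TieBreak V) (ε : ℝ) (E : Finset (Sym2 V)) {s : PeelState V}
    (hs : PeelInv ε E ∅ s) :
    Spec (peelLoop o ε s) fun s' k =>
      PeelInv ε E ∅ s' ∧ s'.low = ∅ ∧
        k ≤ 4 * (#s.low + #s.high) + 9 * #(E \ s.frozen) + 1 := by
  refine (Spec.whileDo (PeelInv ε E ∅)
    (fun s => 4 * (#s.low + #s.high) + 9 * #(E \ s.frozen)) ?_ hs).mono ?_
  · clear hs s
    intro s hs hne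
    refine Spec.bind (Spec.pick o.node hne) fun v k hv => ?_
    obtain ⟨hv, rfl⟩ := hv
    refine Spec.tick_bind ?_
    refine (Spec.forEach o.edge (fun R s' => PeelInv ε E {v} s' ∧ v ∉ s'.high ∧ s'.adj v = R ∧
      #s'.low + #s'.high ≤ #(s.low.erase v) + #s.high ∧
      #(E \ s'.frozen) + #(s.adj v) = #R + #(E \ s.frozen)) 7 ?_ ?_).mono ?_
    · rintro R - e heR s' ⟨hI, hvh, rfl, hc, hE⟩
      obtain ⟨heE, hve⟩ := (hI.isAdj _ _).1 heR
      set u := otherEnd e v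
      set A := (s'.adj.eraseAt v e).eraseAt u e with hAdef
      have hfE : E \ insert e s'.frozen = (E \ s'.frozen).erase e := by
        ext f
        simp only [mem_sdiff, mem_insert, mem_erase]
        tauto
      have hA : IsAdj A (E \ insert e s'.frozen) := hfE ▸ hI.isAdj.erase hve
      have hfs : insert e s'.frozen ⊆ E := insert_subset (mem_sdiff.1 heE).1 hI.frozen_subset
      have hAv : A v = (s'.adj v).erase e := by
        ext f
        simp only [hAdef, mem_eraseAt, mem_erase]
        tauto
      have hAx : ∀ x, x ≠ v → x ≠ u → A x = s'.adj x := fun x h₁ h₂ => by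
        ext f
        simp [hAdef, mem_eraseAt, h₁, h₂]
      have hAsub : ∀ x, A x ⊆ s'.adj x := fun x f hf => by
        simp only [hAdef, mem_eraseAt] at hf
        exact hf.1.1
      have hcard : #(E \ insert e s'.frozen) + #(s.adj v)
          = #((s'.adj v).erase e) + #(E \ s.frozen) := by
        have h₁ := card_erase_add_one heE
        have h₂ := card_erase_add_one heR
        rw [hfE]
        omega
      refine Spec.tick_bind ?_
      split_ifs with hu
      · refine Spec.tick_pure ⟨⟨⟨hA, hfs, ?_, ?_, ?_⟩, ?_, hAv, ?_, hcard⟩, by norm_num⟩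
        · refine disjoint_insert_left.2 ⟨by simp, ?_⟩
          exact hI.disjoint.mono_right (erase_subset _ _)
        · intro x hx
          obtain ⟨hxu, hx⟩ := mem_erase.1 hx
          have hxv : x ≠ v := fun h => hvh (h ▸ hx)
          dsimp only
          rw [← hAdef, hAx x hxv hxu]
          exact hI.degree x hx
        · intro x hxv hx
          rcases hI.mem x hxv (hx.mono (hAsub x)) with h | h
          · exact Or.inl (mem_insert_of_mem h)
          · by_cases hxu : x = u
            · exact Or.inl (mem_insert.2 (Or.inl hxu))
            · exact Or.inr (mem_erase.2 ⟨hxu, h⟩)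
        · exact fun h => hvh (mem_of_mem_erase h)
        · have h₁ := card_erase_add_one hu.1
          have h₂ := card_insert_le u s'.low
          dsimp only
          omega
      · refine Spec.pure ⟨⟨⟨hA, hfs, hI.disjoint, ?_, ?_⟩, hvh, hAv, hc, hcard⟩, by norm_num⟩
        · intro x hx
          have hxv : x ≠ v := fun h => hvh (h ▸ hx)
          by_cases hxu : x = u
          · subst hxu
            exact fun h => hu ⟨hx, h⟩
          · dsimp only
            rw [← hAdef, hAx x hxv hxu]
            exact hI.degree x hx
        · exact fun x hxv hx => hI.mem x hxv (hx.mono (hAsub x))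
    · refine ⟨⟨hs.isAdj, hs.frozen_subset, hs.disjoint.mono_left (erase_subset _ _), hs.degree,
        ?_⟩, disjoint_left.1 hs.disjoint hv, rfl, le_rfl, add_comm _ _⟩
      intro x hxv hx
      exact (hs.mem x (by simp) hx).imp_left fun h => mem_erase.2 ⟨hxv, h⟩
    · rintro s' k ⟨⟨hI, -, hadj, hc, hE⟩, hk⟩
      refine ⟨⟨hI.isAdj, hI.frozen_subset, hI.disjoint, hI.degree, fun x _ hx => ?_⟩, ?_⟩
      · by_cases hxv : x = v
        · subst hxv; simp [hadj] at hx
        · exact hI.mem x hxv hx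
      · have := card_erase_add_one hv
        rw [card_empty] at hE
        omega
  · rintro s' k ⟨h₁, h₂, h₃⟩
    exact ⟨h₁, not_nonempty_iff_eq_empty.1 h₂, by omega⟩

/-- After the peeling every remaining node has degree at least `4`, hence there are at most half as
many nodes as edges. -/
theorem spec_peel (o : TieBreak V) {ε : ℝ} (hε : 0 < ε) (hε' : ε ≤ 1 / 4)
    (E : Finset (Sym2 V)) :
    Spec (peel o ε E) fun s k =>
      IsAdj s.adj (E \ s.frozen) ∧ s.frozen ⊆ E ∧ (∀ v, (s.adj v).Nonempty → v ∈ s.high) ∧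
        2 * #s.high ≤ #(E \ s.frozen) ∧ k ≤ 38 * #E + 3 := by
  refine Spec.bind (spec_buildAdj o E) ?_
  rintro ⟨adj, T⟩ k₁ ⟨hA, hT, hk₁⟩
  dsimp only at hA hT ⊢
  subst hT
  refine Spec.bind (spec_classify o ε hA) fun s k₂ hs => Spec.tick_bind ?_
  obtain ⟨hs, hf, hc, hk₂⟩ := hs
  refine (spec_peelLoop o ε E hs).mono fun s' k₃ hs' => ?_
  obtain ⟨hs', hlow, hk₃⟩ := hs'
  refine ⟨hs'.isAdj, hs'.frozen_subset, fun v hv => ?_, ?_, ?_⟩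
  · simpa [hlow] using hs'.mem v (by simp) hv
  · have h₁ := hs'.isAdj.sum_card_le s'.high
    have h₂ : #s'.high • 4 ≤ ∑ v ∈ s'.high, #(s'.adj v) := by
      refine card_nsmul_le_sum _ _ _ fun v hv => ?_
      have h₃ := not_le.1 (hs'.degree v hv)
      have h₄ : (4 : ℝ) ≤ 1 / ε := by rw [le_div_iff₀ hε]; linarith
      exact_mod_cast (h₄.trans_lt h₃).le
    rw [smul_eq_mul] at h₂
    omega
  · have hTcard : #(E.biUnion Sym2.toFinset) ≤ #E * 2 :=
      card_biUnion_le_card_mul _ _ _ fun e _ => card_toFinset_le_two e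
    rw [hf, sdiff_empty] at hk₃
    omega

/-! ### Rebuilding the hierarchy -/

/-- The properties of level `i < L` of the hierarchy that hold between two updates. By the first one
the sizes of the sets `E^(≥ i)` decay geometrically. -/
structure LevelInv (s : Hierarchy V) (i : ℕ) : Prop where
  card_succ : 4 * #(s.Ege (i + 1)) ≤ 3 * #(s.Ege i)
  card_nodes : #(s.Vge (i + 1)) ≤ #(s.Ege i)
  F_subset : s.F i ⊆ s.Ege i

omit [DecidableEq V] in
theorem LevelInv.congr {s s' : Hierarchy V} {i : ℕ} (h : LevelInv s i)
    (h₁ : s'.Ege i = s.Ege i) (h₂ : s'.Ege (i + 1) ⊆ s.Ege (i + 1))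
    (h₃ : s'.Vge (i + 1) = s.Vge (i + 1)) (h₄ : s'.F i = s.F i) : LevelInv s' i where
  card_succ := by
    have := card_le_card h₂
    have := h.card_succ
    rw [h₁]
    omega
  card_nodes := by rw [h₁, h₃]; exact h.card_nodes
  F_subset := by rw [h₁, h₄]; exact h.F_subset

theorem spec_setF (i : ℕ) (X : Finset (Sym2 V)) (s : Hierarchy V) :
    Spec (setF i X s) fun s' k =>
      (∃ Fa, s' = { s with F := Function.update s.F i X, Fa := Fa }) ∧
        k = #(s.F i) + 2 * #X + 2 := by
  refine Spec.bind (Spec.overwrite _ _) ?_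
  rintro _ _ ⟨rfl, rfl⟩
  refine Spec.bind (Spec.addAll _ _) ?_
  rintro _ _ ⟨rfl, rfl⟩
  exact Spec.pure ⟨⟨_, rfl⟩, by omega⟩

theorem spec_rebuildLevel (o : TieBreak V) {ε : ℝ} (hε : 0 < ε) (hε' : ε ≤ 1 / 4)
    (s : Hierarchy V) (i : ℕ) :
    Spec (rebuildLevel o ε s i) fun s' k =>
      (∃ (X Y : Finset (Sym2 V)) (W : Finset V) (Fa : Finset (Sym2 V)) (h : ℕ → Sym2 V → ℝ),
        s' = { s with
               Vge := Function.update s.Vge (i + 1) W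
               Ege := Function.update s.Ege (i + 1) X
               F := Function.update s.F i Y
               h := h
               Fa := Fa } ∧
        4 * #X ≤ 3 * #(s.Ege i) ∧ #W ≤ #(s.Ege i) ∧ Y ⊆ s.Ege i) ∧
      k ≤ 60 * #(s.Ege i) + #(s.Ege (i + 1)) + #(s.Vge (i + 1)) + #(s.F i) + 12 := by
  refine Spec.bind (spec_peel o hε hε' _) ?_
  rintro p k₁ ⟨hA, hF, hmem, hhigh, hk₁⟩
  refine Spec.bind (Spec.overwrite _ _) ?_
  rintro _ _ ⟨rfl, rfl⟩
  refine Spec.bind (spec_setF _ _ _) ?_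
  rintro _ _ ⟨⟨Fa, rfl⟩, rfl⟩
  refine Spec.bind (Spec.overwrite _ _) ?_
  rintro _ _ ⟨rfl, rfl⟩
  refine Spec.bind (Spec.removeAll _ _) ?_
  rintro _ _ ⟨rfl, rfl⟩
  refine Spec.bind (spec_degreeSplit o hA hmem) ?_
  rintro X k₂ ⟨hX, hk₂⟩
  refine Spec.bind (Spec.overwrite _ _) ?_
  rintro _ _ ⟨rfl, rfl⟩
  refine Spec.tick_bind (Spec.tick_pure ?_)
  have h₁ : #(s.Ege i \ p.frozen) ≤ #(s.Ege i) := card_le_card sdiff_subset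
  have h₂ := card_le_card hF
  refine ⟨⟨_, _, _, _, _, rfl, by omega, by omega, hF⟩, ?_⟩
  simp only [card_empty]
  omega

/-- The cost of a level is linear in the size of its edge set and in the sizes of the sets that are
overwritten, which are at most `b i`. As both decay geometrically with ratio `3 / 4`, the sum over
all levels is at most `4` times the bound for the first level. -/
theorem spec_rebuildLevels (o : TieBreak V) {ε : ℝ} (hε : 0 < ε) (hε' : ε ≤ 1 / 4) {b : ℕ → ℕ}
    (n j : ℕ) (hb : ∀ i, j ≤ i → i < j + n → 4 * b (i + 1) ≤ 3 * b i) (s : Hierarchy V)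
    (hs : ∀ i, j ≤ i → i < j + n →
      #(s.Ege (i + 1)) ≤ b i ∧ #(s.Vge (i + 1)) ≤ b i ∧ #(s.F i) ≤ b i) :
    Spec ((List.range' j n).foldlM (rebuildLevel o ε) s) fun s' k =>
      s'.Ea = s.Ea ∧ s'.Ep = s.Ep ∧ s'.D = s.D ∧
        (∀ i ≤ j, s'.Ege i = s.Ege i ∧ s'.Vge i = s.Vge i) ∧
        (∀ i, i < j ∨ j + n ≤ i → s'.F i = s.F i) ∧
        (∀ i, j ≤ i → i < j + n → LevelInv s' i) ∧
        #(s'.Ege (j + n)) ≤ #(s.Ege j) ∧ k ≤ 240 * #(s.Ege j) + 12 * b j + 12 * n := by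
  induction n generalizing j s with
  | zero =>
    exact Spec.pure ⟨rfl, rfl, rfl, fun _ _ => ⟨rfl, rfl⟩, fun _ _ => rfl, fun i _ _ => by omega,
      le_rfl, by omega⟩
  | succ n ih =>
    rw [List.range'_succ, List.foldlM_cons]
    refine Spec.bind (spec_rebuildLevel o hε hε' s j) ?_
    rintro s₁ k₁ ⟨⟨X, Y, W, Fa, h, rfl, hX, hW, hY⟩, hk₁⟩
    refine (ih (j + 1) (fun i h₁ h₂ => hb i (by omega) (by omega)) _ fun i h₁ h₂ => ?_).mono ?_
    · have hij : i ≠ j := by omega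
      simpa [hij] using hs i (by omega) (by omega)
    · rintro s' k₂ ⟨hEa, hEp, hD, hle, hF, hL, hlast, hk₂⟩
      have hj : s'.Ege (j + 1) = X := by simp [(hle (j + 1) le_rfl).1]
      have hVj : s'.Vge (j + 1) = W := by simp [(hle (j + 1) le_rfl).2]
      have hEj : s'.Ege j = s.Ege j := by simp [(hle j (by omega)).1]
      have hFj : s'.F j = Y := by simp [hF j (by omega)]
      simp only [Function.update_self] at hlast hk₂
      refine ⟨hEa, hEp, hD, fun i hi => ?_, fun i hi => ?_, fun i h₁ h₂ => ?_, ?_, ?_⟩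
      · have hij : i ≠ j + 1 := by omega
        simpa [hij] using hle i (by omega)
      · have hij : i ≠ j := by omega
        simpa [hij] using hF i (by omega)
      · rcases h₁.eq_or_lt with rfl | h₁
        · exact ⟨by rw [hj, hEj]; exact hX, by rw [hVj, hEj]; exact hW, by rw [hFj, hEj]; exact hY⟩
        · exact hL i (by omega) (by omega)
      · rw [show j + (n + 1) = j + 1 + n by omega]
        omega
      · have := hs j le_rfl (by omega)
        have := hb j le_rfl (by omega)
        omega

theorem spec_removeAll_levels {b : ℕ → ℕ} (F : ℕ → Finset (Sym2 V)) (n j : ℕ)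
    (hb : ∀ i, j ≤ i → i < j + n → 4 * b (i + 1) ≤ 3 * b i)
    (hF : ∀ i, j ≤ i → i ≤ j + n → #(F i) ≤ b i) (X : Finset (Sym2 V)) :
    Spec ((List.range' j (n + 1)).foldlM (fun Fa i => removeAll Fa (F i)) X) fun _ k =>
      k ≤ 4 * b j + n + 1 := by
  induction n generalizing j X with
  | zero =>
    have := hF j le_rfl le_rfl
    rw [List.range'_succ, List.foldlM_cons]
    refine Spec.bind (Spec.removeAll _ _) ?_
    rintro _ _ ⟨rfl, rfl⟩
    exact Spec.pure (by omega)
  | succ n ih =>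
    rw [List.range'_succ, List.foldlM_cons]
    refine Spec.bind (Spec.removeAll _ _) ?_
    rintro _ _ ⟨rfl, rfl⟩
    refine (ih (j + 1) (fun i h₁ h₂ => hb i (by omega) (by omega))
      (fun i h₁ h₂ => hF i (by omega) (by omega)) _).mono fun _ k hk => ?_
    have := hF j le_rfl (by omega)
    have := hb j le_rfl (by omega)
    omega

theorem spec_rebuild (o : TieBreak V) {ε : ℝ} (hε : 0 < ε) (hε' : ε ≤ 1 / 4) {b : ℕ → ℕ}
    {L j : ℕ} (hj : j ≤ L) (hb : ∀ i, j ≤ i → i < L → 4 * b (i + 1) ≤ 3 * b i)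
    {s : Hierarchy V}
    (hs : ∀ i, j ≤ i → i < L → #(s.Ege (i + 1)) ≤ b i ∧ #(s.Vge (i + 1)) ≤ b i)
    (hF : ∀ i, j ≤ i → i ≤ L → #(s.F i) ≤ b i) :
    Spec (rebuild o ε L j s) fun s' k =>
      s'.Ea = s.Ea ∧ s'.Ep = s.Ep ∧ s'.D = s.D ∧
        (∀ i ≤ j, s'.Ege i = s.Ege i ∧ s'.Vge i = s.Vge i) ∧ (∀ i < j, s'.F i = s.F i) ∧
        (∀ i, j ≤ i → i < L → LevelInv s' i) ∧ s'.F L ⊆ s'.Ege L ∧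
        k ≤ 250 * #(s.Ege j) + 20 * b j + 20 * (L + 1) := by
  obtain ⟨n, rfl⟩ := Nat.exists_eq_add_of_le hj
  have hanti : b (j + n) ≤ b j := by
    suffices ∀ m ≤ n, b (j + m) ≤ b j from this n le_rfl
    intro m
    induction m with
    | zero => simp
    | succ m ih =>
      intro hm
      have := hb (j + m) (by omega) (by omega)
      have := ih (by omega)
      rw [← add_assoc]
      omega
  unfold rebuild
  rw [show j + n + 1 - j = n + 1 by omega, show j + n - j = n by omega]
  refine Spec.bind (spec_removeAll_levels s.F n j hb hF s.Fa) fun Fa k₁ hk₁ => ?_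
  refine Spec.bind (spec_rebuildLevels o hε hε' n j hb _ fun i h₁ h₂ =>
    ⟨(hs i h₁ h₂).1, (hs i h₁ h₂).2, hF i h₁ h₂.le⟩) fun s₁ k₂ hs₁ => ?_
  obtain ⟨hEa, hEp, hD, hle, hF₁, hL, hlast, hk₂⟩ := hs₁
  refine (spec_setF _ _ _).mono ?_
  rintro _ k₃ ⟨⟨Fa', rfl⟩, rfl⟩
  have hFL := hF (j + n) (by omega) le_rfl
  have hFL' : s₁.F (j + n) = s.F (j + n) := hF₁ _ (Or.inr le_rfl)
  refine ⟨hEa, hEp, hD, hle, fun i hi => ?_, fun i h₁ h₂ => ?_, ?_, ?_⟩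
  · have : i ≠ j + n := by omega
    simpa [this] using hF₁ i (Or.inl hi)
  · have : i ≠ j + n := by omega
    exact (hL i h₁ h₂).congr rfl subset_rfl rfl (by simp [this])
  · simp
  · rw [hFL']
    dsimp only at hk₂ hlast
    omega

theorem spec_staticSparsify (o : TieBreak V) {ε lam : ℝ} (hε : 0 < ε) (hε' : ε ≤ 1 / 4)
    {b : ℕ → ℕ} {L : ℕ} (hb : ∀ i < L, 4 * b (i + 1) ≤ 3 * b i) {s : Hierarchy V}
    (h₀ : #(s.Ege 0) ≤ b 0)
    (hs : ∀ i < L, #(s.Ege (i + 1)) ≤ b i ∧ #(s.Vge (i + 1)) ≤ b i)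
    (hF : ∀ i ≤ L, #(s.F i) ≤ b i) :
    Spec (staticSparsify o ε lam L s) fun s' k =>
      s'.Ea = s.Ea ∧ s'.Ep = s.Ep ∧ s'.D = s.D ∧ s'.Ege 0 = s.Ea ∧
        (∀ i < L, LevelInv s' i) ∧ s'.F L ⊆ s'.Ege L ∧
        k ≤ 252 * #s.Ea + 21 * b 0 + 22 * (L + 1) := by
  refine Spec.bind (Spec.overwrite _ _) ?_
  rintro _ _ ⟨rfl, rfl⟩
  refine Spec.tick_bind ?_
  refine (spec_rebuild o (s := { s with
    Ege := Function.update s.Ege 0 s.Ea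
    h := Function.update s.h 0 (fun e => if e ∈ s.Ea then lam else s.h 0 e) })
    hε hε' (Nat.zero_le L) (fun i _ => hb i) (fun i _ hi => ?_)
    fun i _ => hF i).mono ?_
  · simpa using hs i hi
  · rintro s' k ⟨hEa, hEp, hD, hle, -, hL, hFL, hk⟩
    simp only [Function.update_self] at hk
    refine ⟨hEa, hEp, hD, by simp [(hle 0 le_rfl).1], fun i hi => hL i (Nat.zero_le i) hi, hFL, ?_⟩
    omega

/-! ### Clean-Up -/

theorem spec_cleanUp_levels (n j : ℕ) (s : Hierarchy V) :
    Spec ((List.range' j n).foldlM (fun (s : Hierarchy V) i => do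
      let E' ← removeAll (s.Ege i) (s.D i)
      let F' ← removeAll (s.F i) (s.D i)
      let D' ← overwrite (s.D i) ∅
      pure { s with
             Ege := Function.update s.Ege i E'
             F := Function.update s.F i F'
             D := Function.update s.D i D' }) s) fun s' k =>
      s' = { s with
             Ege := fun i => if j ≤ i ∧ i < j + n then s.Ege i \ s.D i else s.Ege i
             F := fun i => if j ≤ i ∧ i < j + n then s.F i \ s.D i else s.F i
             D := fun i => if j ≤ i ∧ i < j + n then ∅ else s.D i } ∧
        k = ∑ i ∈ Ico j (j + n), (3 * #(s.D i) + 3) := by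
  induction n generalizing j s with
  | zero =>
    refine Spec.pure ⟨?_, by simp⟩
    have : ∀ i, ¬ (j ≤ i ∧ i < j + 0) := fun i => by omega
    simp only [this, if_false]
  | succ n ih =>
    rw [List.range'_succ, List.foldlM_cons]
    refine Spec.bind (P := fun s' k => s' = { s with
             Ege := Function.update s.Ege j (s.Ege j \ s.D j)
             F := Function.update s.F j (s.F j \ s.D j)
             D := Function.update s.D j ∅ } ∧ k = 3 * #(s.D j) + 3) ?_ ?_
    · refine Spec.bind (Spec.removeAll _ _) ?_
      rintro _ _ ⟨rfl, rfl⟩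
      refine Spec.bind (Spec.removeAll _ _) ?_
      rintro _ _ ⟨rfl, rfl⟩
      refine Spec.bind (Spec.overwrite _ _) ?_
      rintro _ _ ⟨rfl, rfl⟩
      refine Spec.pure ⟨rfl, ?_⟩
      rw [card_empty]
      omega
    · rintro _ _ ⟨rfl, rfl⟩
      refine (ih (j + 1) _).mono ?_
      rintro _ _ ⟨rfl, rfl⟩
      constructor
      · congr 1 <;> funext i <;> by_cases hij : i = j
        all_goals first
          | (subst hij; simp)
          | (have : (j + 1 ≤ i ∧ i < j + 1 + n) ↔ (j ≤ i ∧ i < j + (n + 1)) := by omega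
             simp only [ne_eq, hij, not_false_eq_true, Function.update_of_ne, this])
      · rw [sum_eq_sum_Ico_succ_bot (a := j) (b := j + (n + 1)) (by omega),
          show j + (n + 1) = j + 1 + n by omega]
        congr 1
        refine sum_congr rfl fun i hi => ?_
        have : i ≠ j := by have := (mem_Ico.1 hi).1; omega
        simp [this]

/-- The number of stored pairs of a level up to `L` and an edge that is dead on it. -/
def numDead (L : ℕ) (s : Hierarchy V) : ℕ := ∑ i ∈ range (L + 1), #(s.D i)

theorem spec_cleanUp {L j : ℕ} (hj : j ≤ L) (s : Hierarchy V) :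
    Spec (cleanUp L j s) fun s' k =>
      s' = { s with
             Ege := fun i => if j ≤ i ∧ i ≤ L then s.Ege i \ s.D i else s.Ege i
             F := fun i => if j ≤ i ∧ i ≤ L then s.F i \ s.D i else s.F i
             D := fun i => if j ≤ i ∧ i ≤ L then ∅ else s.D i } ∧
        k + 3 * numDead L s' ≤ 3 * numDead L s + 3 * (L + 1) ∧
        #(s.D j) + numDead L s' ≤ numDead L s := by
  refine (spec_cleanUp_levels (L + 1 - j) j s).mono ?_
  rintro s' k ⟨rfl, rfl⟩
  have hiff : ∀ i, (j ≤ i ∧ i < j + (L + 1 - j)) ↔ (j ≤ i ∧ i ≤ L) := fun i => by omega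
  simp only [hiff]
  have hsplit : ∀ f : ℕ → ℕ, ∑ i ∈ range (L + 1), f i
      = ∑ i ∈ Ico 0 j, f i + ∑ i ∈ Ico j (L + 1), f i := fun f => by
    rw [range_eq_Ico, sum_Ico_consecutive _ (Nat.zero_le j) (by omega)]
  have h₁ : ∑ i ∈ Ico 0 j, #(if j ≤ i ∧ i ≤ L then ∅ else s.D i) = ∑ i ∈ Ico 0 j, #(s.D i) :=
    sum_congr rfl fun i hi => by
      have : ¬ (j ≤ i ∧ i ≤ L) := by have := (mem_Ico.1 hi).2; omega
      simp [this]
  have h₂ : ∑ i ∈ Ico j (L + 1), #(if j ≤ i ∧ i ≤ L then ∅ else s.D i) = 0 :=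
    sum_eq_zero fun i hi => by
      have : j ≤ i ∧ i ≤ L := by have := mem_Ico.1 hi; omega
      simp [this]
  have h₃ : #(s.D j) ≤ ∑ i ∈ Ico j (L + 1), #(s.D i) :=
    single_le_sum (f := fun i => #(s.D i)) (fun _ _ => Nat.zero_le _)
      (mem_Ico.2 ⟨le_rfl, by omega⟩)
  refine ⟨trivial, ?_, ?_⟩
  · rw [numDead, numDead, hsplit, hsplit, h₁, h₂, show j + (L + 1 - j) = L + 1 by omega,
      sum_add_distrib, ← mul_sum, sum_const, Nat.card_Ico, smul_eq_mul]
    omega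
  · rw [numDead, numDead, hsplit, hsplit, h₁, h₂]
    omega

/-! ### Amortized analysis of the updates -/

/-- The invariant that holds between two updates. -/
structure Invariant (L : ℕ) (s : Hierarchy V) : Prop where
  Ege_zero : s.Ege 0 ⊆ s.Ea ∪ s.D 0
  level : ∀ i < L, LevelInv s i
  F_last : s.F L ⊆ s.Ege L

theorem Invariant.F_subset {L : ℕ} {s : Hierarchy V} (h : Invariant L s) {i : ℕ} (hi : i ≤ L) :
    s.F i ⊆ s.Ege i := by
  rcases hi.eq_or_lt with rfl | hi
  · exact h.F_last
  · exact (h.level i hi).F_subset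

/-- The potential, in units of `600 / ε`: every passive edge and every dead copy of an edge counts
one. -/
def numPending (L : ℕ) (s : Hierarchy V) : ℕ := #s.Ep + numDead L s

theorem spec_handleInsertion (o : TieBreak V) {ε : ℝ} (lam : ℝ) (hε : 0 < ε) (hε' : ε ≤ 1 / 4)
    (L : ℕ) (e : Sym2 V) {s : Hierarchy V} (hs : Invariant L s) :
    Spec (handleInsertion o ε lam L e s) fun s' k => Invariant L s' ∧
      (k : ℝ) + 600 / ε * numPending L s' ≤ 600 / ε * numPending L s + 640 / ε * (L + 1) := by
  have hε₁ : 1 ≤ 1 / ε := by rw [le_div_iff₀ hε]; linarith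
  have hins : #(insert e s.Ep) ≤ #s.Ep + 1 := card_insert_le _ _
  have hinsR : (#(insert e s.Ep) : ℝ) ≤ #s.Ep + 1 := by exact_mod_cast hins
  have hL : (0 : ℝ) ≤ L := Nat.cast_nonneg L
  -- the terms with a factor `1 / ε` are compared as multiples of `r`
  set r := 1 / ε with hr
  have hrL : (L : ℝ) ≤ r * L := by nlinarith
  rw [show 600 / ε = 600 * r by rw [hr]; ring, show 640 / ε = 640 * r by rw [hr]; ring]
  refine Spec.tick_bind ?_
  dsimp only
  split_ifs with hlarge
  · refine Spec.bind (spec_cleanUp (Nat.zero_le L) _) ?_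
    rintro _ k₁ ⟨rfl, hk₁, -⟩
    refine Spec.bind (Spec.addAll _ _) ?_
    rintro _ _ ⟨rfl, rfl⟩
    refine Spec.bind (Spec.overwrite _ _) ?_
    rintro _ _ ⟨rfl, rfl⟩
    refine (spec_staticSparsify o (b := fun i => #(s.Ege i)) hε hε'
      (fun i hi => (hs.level i hi).card_succ) ?_ (fun i hi => ⟨?_, ?_⟩) fun i hi => ?_).mono ?_
    · simpa using card_le_card sdiff_subset
    · have h₁ := (hs.level i hi).card_succ
      have h₂ : #(s.Ege (i + 1) \ s.D (i + 1)) ≤ #(s.Ege (i + 1)) := card_le_card sdiff_subset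
      have h₃ : i + 1 ≤ L := hi
      simp only [Nat.zero_le, true_and, h₃, if_true]
      omega
    · exact (hs.level i hi).card_nodes
    · simp only [Nat.zero_le, true_and, hi, if_true]
      exact (card_le_card sdiff_subset).trans (card_le_card (hs.F_subset hi))
    · rintro s' k₂ ⟨hEa, hEp, hD, hE₀, hlev, hlast, hk₂⟩
      refine ⟨⟨by rw [hE₀, hEa]; exact subset_union_left, hlev, hlast⟩, ?_⟩
      have hdead : numDead L s' = 0 := by
        refine sum_eq_zero fun i hi => ?_
        have : i ≤ L := by simpa [Nat.lt_succ_iff] using hi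
        simp [hD, this]
      have hpend : numPending L s' = 0 := by rw [numPending, hdead, hEp, card_empty]
      have h₀ : #(s.Ege 0) ≤ #s.Ea + #(s.D 0) := (card_le_card hs.Ege_zero).trans (card_union_le _ _)
      have hD₀ : #(s.D 0) ≤ numDead L s :=
        single_le_sum (f := fun i => #(s.D i)) (fun _ _ => Nat.zero_le _) (by simp)
      have hun : #(s.Ea ∪ insert e s.Ep) ≤ #s.Ea + #(insert e s.Ep) := card_union_le _ _
      have hk₁' : k₁ ≤ 3 * numDead L s + 3 * (L + 1) := by
        have : numDead L { s with Ep := insert e s.Ep } = numDead L s := rfl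
        omega
      have hnat : 2 + (k₁ + (#(insert e s.Ep) + 1 + (#(insert e s.Ep) + #(∅ : Finset (Sym2 V)) + 1
          + k₂))) ≤ 273 * #s.Ea + 254 * #(insert e s.Ep) + 24 * numDead L s + 29 * (L + 1) := by
        rw [card_empty]
        dsimp only at hk₂
        omega
      have hreal := (Nat.cast_le (α := ℝ)).2 hnat
      push_cast at hreal ⊢
      -- the active edges are paid for by the passive edges
      have hEaEp : (#s.Ea : ℝ) ≤ r * #(insert e s.Ep) := by
        rw [hr, one_div, inv_mul_eq_div, le_div_iff₀ hε]
        linarith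
      have hEpr : (#(insert e s.Ep) : ℝ) ≤ r * #(insert e s.Ep) :=
        le_mul_of_one_le_left (Nat.cast_nonneg _) hε₁
      have hdr : (numDead L s : ℝ) ≤ r * numDead L s :=
        le_mul_of_one_le_left (Nat.cast_nonneg _) hε₁
      have hinsr : r * #(insert e s.Ep) ≤ r * (#s.Ep + 1) :=
        mul_le_mul_of_nonneg_left hinsR (by linarith)
      have hp₁ : 0 ≤ r * (#s.Ep : ℝ) := by positivity
      have hp₂ : 0 ≤ r * (numDead L s : ℝ) := by positivity
      rw [hpend, numPending]
      push_cast
      linarith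
  · refine Spec.pure ⟨⟨hs.Ege_zero, fun i hi => (hs.level i hi).congr rfl subset_rfl rfl rfl,
      hs.F_last⟩, ?_⟩
    have hd : numDead L { s with Ep := insert e s.Ep } = numDead L s := rfl
    have hpend : (numPending L { s with Ep := insert e s.Ep } : ℝ) ≤ numPending L s + 1 := by
      rw [numPending, numPending, hd]
      dsimp only
      exact_mod_cast (by omega)
    have := mul_le_mul_of_nonneg_left hpend (show 0 ≤ 600 * r by linarith)
    push_cast
    linarith

theorem spec_handleDeletion (o : TieBreak V) {ε : ℝ} (hε : 0 < ε) (hε' : ε ≤ 1 / 4)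
    (L : ℕ) (e : Sym2 V) {s : Hierarchy V} (hs : Invariant L s) :
    Spec (handleDeletion o ε L e s) fun s' k => Invariant L s' ∧
      (k : ℝ) + 600 / ε * numPending L s' ≤ 600 / ε * numPending L s + 640 / ε * (L + 1) := by
  have hε₁ : 1 ≤ 1 / ε := by rw [le_div_iff₀ hε]; linarith
  have hL : (0 : ℝ) ≤ L := Nat.cast_nonneg L
  -- the terms with a factor `1 / ε` are compared as multiples of `r`
  set r := 1 / ε with hr
  have hrL : (L : ℝ) ≤ r * L := by nlinarith
  rw [show 600 / ε = 600 * r by rw [hr]; ring, show 640 / ε = 640 * r by rw [hr]; ring]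
  unfold handleDeletion
  refine Spec.tick_bind ?_
  split_ifs with hmem
  · refine Spec.tick_pure ⟨⟨hs.Ege_zero, fun i hi => (hs.level i hi).congr rfl subset_rfl rfl rfl,
      hs.F_last⟩, ?_⟩
    have hpend : (numPending L { s with Ep := s.Ep.erase e } : ℝ) ≤ numPending L s := by
      have : #(s.Ep.erase e) ≤ #s.Ep := card_le_card (erase_subset _ _)
      have hd : numDead L { s with Ep := s.Ep.erase e } = numDead L s := rfl
      rw [numPending, numPending, hd]
      dsimp only
      exact_mod_cast (by omega)
    have := mul_le_mul_of_nonneg_left hpend (show 0 ≤ 600 * r by linarith)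
    push_cast
    linarith
  · refine Spec.tick_bind ?_
    dsimp only
    set m := ((Finset.range (L + 1)).filter (fun i => e ∈ s.Ege i)).sup id
    have hm : m ≤ L := Finset.sup_le fun i hi => by
      have := mem_range.1 (mem_filter.1 hi).1
      simp only [id]; omega
    refine Spec.tick_bind (Spec.tick_bind ?_)
    set s₁ : Hierarchy V := { s with
      Ea := s.Ea.erase e
      Fa := s.Fa.erase e
      D := fun i => if i ≤ m then insert e (s.D i) else s.D i } with hs₁
    have hI : Invariant L s₁ := by
      refine ⟨fun f hf => ?_, fun i hi => (hs.level i hi).congr rfl subset_rfl rfl rfl, hs.F_last⟩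
      have := mem_union.1 (hs.Ege_zero hf)
      simp only [hs₁, mem_union, mem_erase, Nat.zero_le, if_true, mem_insert]
      tauto
    have hpend₁ : numPending L s₁ ≤ numPending L s + (L + 1) := by
      have : numDead L s₁ ≤ ∑ i ∈ range (L + 1), (#(s.D i) + 1) := sum_le_sum fun i _ => by
        simp only [hs₁]
        split_ifs
        · exact card_insert_le _ _
        · omega
      rw [sum_add_distrib, sum_const, card_range, smul_eq_mul, mul_one] at this
      have hEp : s₁.Ep = s.Ep := rfl
      simp only [numPending, numDead, hEp] at this ⊢
      omega
    have hpend₁R : 600 * r * (numPending L s₁ : ℝ) ≤ 600 * r * (numPending L s + (L + 1)) :=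
      mul_le_mul_of_nonneg_left (by exact_mod_cast hpend₁) (by linarith)
    have hmR : (m : ℝ) ≤ L := by exact_mod_cast hm
    cases hfind : (List.range (L + 1)).find?
      (fun i => decide ((#(s₁.D i) : ℝ) > ε * (#(s₁.Ege i) : ℝ))) with
    | none =>
      refine Spec.pure ⟨hI, ?_⟩
      push_cast
      linarith
    | some j =>
      have hj : j ≤ L := by
        have := List.mem_of_find?_eq_some hfind
        simpa [Nat.lt_succ_iff] using this
      have hlarge : (#(s₁.D j) : ℝ) > ε * (#(s₁.Ege j) : ℝ) := by
        simpa using List.find?_some hfind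
      change Spec (cleanUp L j s₁ >>= fun s => rebuild o ε L j s) _
      clear_value s₁
      refine Spec.bind (spec_cleanUp hj s₁) fun s₂ k₁ hs₂ => ?_
      obtain ⟨hs₂, hk₁, hDj⟩ := hs₂
      have hE : ∀ i, s₂.Ege i ⊆ s₁.Ege i := fun i => by
        rw [hs₂]
        dsimp only
        split_ifs
        · exact sdiff_subset
        · exact subset_rfl
      have hF : ∀ i ≤ L, s₂.F i ⊆ s₂.Ege i := fun i hi => by
        rw [hs₂]
        dsimp only
        split_ifs
        · exact sdiff_subset_sdiff (hI.F_subset hi) subset_rfl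
        · exact hI.F_subset hi
      have hV : s₂.Vge = s₁.Vge := by rw [hs₂]
      refine (spec_rebuild o (b := fun i => #(s₁.Ege i)) hε hε' hj
        (fun i _ hi => (hI.level i hi).card_succ) (fun i _ hi => ⟨?_, ?_⟩)
        fun i _ hi => card_le_card ((hF i hi).trans (hE i))).mono ?_
      · have := (hI.level i hi).card_succ
        have := card_le_card (hE (i + 1))
        omega
      · rw [hV]; exact (hI.level i hi).card_nodes
      · rintro s' k₂ ⟨hEa, hEp, hD, hle, hFlt, hlev, hlast, hk₂⟩
        refine ⟨⟨?_, fun i hi => ?_, hlast⟩, ?_⟩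
        · rw [(hle 0 (Nat.zero_le j)).1, hEa, hD, hs₂]
          dsimp only
          intro f hf
          split_ifs at hf ⊢ with h
          · have := mem_union.1 (hI.Ege_zero (mem_sdiff.1 hf).1)
            have := (mem_sdiff.1 hf).2
            exact mem_union.2 (Or.inl (by tauto))
          · exact hI.Ege_zero hf
        · rcases lt_or_ge i j with hij | hij
          · have hnot : ¬ (j ≤ i ∧ i ≤ L) := by omega
            refine (hI.level i hi).congr ?_ ?_ ?_ ?_
            · rw [(hle i hij.le).1, hs₂]; simp only [hnot, if_false]
            · rw [(hle (i + 1) hij).1]; exact hE _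
            · rw [(hle (i + 1) hij).2, hV]
            · rw [hFlt i hij, hs₂]; simp only [hnot, if_false]
          · exact hlev i hij hi
        · have hEp₂ : s₂.Ep = s₁.Ep := by rw [hs₂]
          have hdead : numDead L s' = numDead L s₂ := by rw [numDead, numDead, hD]
          have hcard := card_le_card (hE j)
          have hpend : numPending L s' + #(s₁.D j) ≤ numPending L s₁ := by
            rw [numPending, numPending, hEp, hEp₂, hdead]
            omega
          -- the dead edges that get removed pay for the clean-up and for the rebuilding
          have hk : k₁ + k₂ + 3 * numPending L s'
              ≤ 3 * numPending L s₁ + 270 * #(s₁.Ege j) + 23 * (L + 1) := by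
            simp only [numPending, hEp, hEp₂, hdead]
            omega
          have hEj : (#(s₁.Ege j) : ℝ) ≤ r * #(s₁.D j) := by
            rw [hr, one_div, inv_mul_eq_div, le_div_iff₀ hε]
            linarith
          have hkR := (Nat.cast_le (α := ℝ)).2 hk
          have hpendR := (Nat.cast_le (α := ℝ)).2 hpend
          have hmul := mul_le_mul_of_nonneg_left hpendR (show 0 ≤ 600 * r - 3 by linarith)
          have hDr : (#(s₁.D j) : ℝ) ≤ r * #(s₁.D j) :=
            le_mul_of_one_le_left (Nat.cast_nonneg _) hε₁
          push_cast at hkR hmul ⊢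
          linarith

theorem spec_foldlM_handleUpdate (o : TieBreak V) {ε : ℝ} (lam : ℝ) (hε : 0 < ε)
    (hε' : ε ≤ 1 / 4) (L : ℕ) (us : List (Update V)) {s : Hierarchy V} (hs : Invariant L s) :
    Spec (us.foldlM (handleUpdate o ε lam L) s) fun _ k =>
      (k : ℝ) ≤ 600 / ε * numPending L s + 640 / ε * (L + 1) * us.length := by
  induction us generalizing s with
  | nil =>
    refine Spec.pure ?_
    simp only [Nat.cast_zero, List.length_nil, mul_zero, add_zero]
    positivity
  | cons u us ih =>
    rw [List.foldlM_cons]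
    have hu : Spec (handleUpdate o ε lam L s u) fun s' k => Invariant L s' ∧
        (k : ℝ) + 600 / ε * numPending L s'
          ≤ 600 / ε * numPending L s + 640 / ε * (L + 1) := by
      cases u with
      | insertion e => exact spec_handleInsertion o lam hε hε' L e hs
      | deletion e => exact spec_handleDeletion o hε hε' L e hs
    refine Spec.bind hu fun s' k hk => (ih hk.1).mono fun _ k' hk' => ?_
    have := hk.2
    rw [List.length_cons]
    push_cast
    linarith

theorem spec_preprocess [Fintype V] (o : TieBreak V) {ε : ℝ} (lam : ℝ) (hε : 0 < ε)
    (hε' : ε ≤ 1 / 4) (L : ℕ) (E : Finset (Sym2 V)) :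
    Spec (preprocess V o ε lam L E) fun s _ => Invariant L s ∧ numPending L s = 0 := by
  refine Spec.bind (Spec.overwrite _ _) ?_
  rintro _ _ ⟨rfl, rfl⟩
  refine (spec_staticSparsify o (b := fun _ => 0) hε hε' (by simp) ?_ ?_ ?_).mono ?_
  · simp [Hierarchy.initial]
  · simp [Hierarchy.initial]
  · simp [Hierarchy.initial]
  · rintro s k ⟨hEa, hEp, hD, hE₀, hlev, hlast, -⟩
    refine ⟨⟨by rw [hE₀, hEa]; exact subset_union_left, hlev, hlast⟩, ?_⟩
    simp [numPending, numDead, hEp, hD, Hierarchy.initial]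

theorem exists_totalUpdateTime_le [Fintype V] (o : TieBreak V) (β : ℝ) {ε : ℝ} (lam : ℝ)
    (hε : 0 < ε) (hε' : ε ≤ 1 / 4) (E : Finset (Sym2 V)) (us : List (Update V)) :
    ∃ T : ℕ, (totalUpdateTime V o β ε lam E us).run' 0 = some T ∧
      (T : ℝ) ≤ 640 / ε * (numLevels β lam + 1) * us.length := by
  obtain ⟨s, k, h₁, hs, hpend⟩ := spec_preprocess o lam hε hε' (numLevels β lam) E 0
  obtain ⟨s', k', h₂, hk'⟩ :=
    spec_foldlM_handleUpdate o lam hε hε' (numLevels β lam) us hs (0 + k)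
  refine ⟨k', ?_, by simpa [hpend] using hk'⟩
  have : (totalUpdateTime V o β ε lam E us).run 0 = some (0 + k + k' - (0 + k), 0 + k + k') := by
    simp only [zero_add] at h₁ h₂
    simp [totalUpdateTime, h₁, h₂]
  rw [StateT.run'_eq, this]
  simp

/-! ### The parameters -/

theorem numLevels_le {β lam : ℝ} (hlam : 0 < lam) (h : lam < β) :
    (numLevels β lam : ℝ) ≤ Real.logb 2 (β / lam) := by
  have h₁ : 1 < β / lam := (one_lt_div hlam).2 h
  unfold numLevels
  set S := {k : ℕ | β / 2 ≤ 2 ^ k * lam ∧ 2 ^ k * lam < β}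
  have hS : ∀ k ∈ S, (k : ℝ) ≤ Real.logb 2 (β / lam) := fun k hk => by
    rw [Real.le_logb_iff_rpow_le one_lt_two (by linarith), Real.rpow_natCast, le_div_iff₀ hlam]
    exact hk.2.le
  rcases S.eq_empty_or_nonempty with hE | hne
  · rw [hE, csSup_empty]
    simpa using (Real.logb_pos one_lt_two h₁).le
  · exact hS _ (Nat.sSup_mem hne
      ⟨⌊Real.logb 2 (β / lam)⌋₊, fun k hk => Nat.le_floor (hS k hk)⟩)

namespace Parameters

variable {n : ℕ} {δ β ε lam : ℝ}

theorem two_le (h : Parameters n δ β ε lam) : 2 ≤ n := by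
  by_contra hn
  have h₀ : Real.logb 2 n = 0 := by
    have : n = 0 ∨ n = 1 := by omega
    rcases this with rfl | rfl <;> simp
  have := h.δ_eq_ε
  rw [h₀, mul_zero] at this
  exact h.δ_pos.ne' this

theorem one_le_logb (h : Parameters n δ β ε lam) : 1 ≤ Real.logb 2 n := by
  have : (2 : ℝ) ≤ n := by exact_mod_cast h.two_le
  rw [Real.le_logb_iff_rpow_le one_lt_two (by linarith), Real.rpow_one]
  exact this

theorem ε_pos (h : Parameters n δ β ε lam) : 0 < ε := by
  have h₁ := h.δ_pos
  have h₂ := h.one_le_logb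
  rw [h.δ_eq_ε] at h₁
  nlinarith

theorem ε_le (h : Parameters n δ β ε lam) : ε ≤ 1 / 4 := by
  have h₁ := h.δ_le
  have h₂ := h.one_le_logb
  have h₃ := h.ε_pos
  rw [h.δ_eq_ε] at h₁
  nlinarith

theorem lam_pos (h : Parameters n δ β ε lam) : 0 < lam := by
  have : (0 : ℝ) < n := by exact_mod_cast (by have := h.two_le; omega : 0 < n)
  exact (div_pos h.δ_pos (by positivity)).trans_le h.le_lam

theorem logb_div_le (h : Parameters n δ β ε lam) :
    Real.logb 2 (β / lam) ≤ 2 * Real.logb 2 n := by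
  have hn : (0 : ℝ) < n := by exact_mod_cast (by have := h.two_le; omega : 0 < n)
  have hlam := h.lam_pos
  have hβ : 0 < β := hlam.trans h.lam_lt
  have h₁ := (div_le_iff₀ (by positivity)).1 h.le_lam
  have h₂ : β / lam ≤ (n : ℝ) ^ 2 := by
    rw [div_le_iff₀ hlam]
    have := h.δ_eq_β
    linarith
  refine (Real.logb_le_logb_of_le one_lt_two (by positivity) h₂).trans_eq ?_
  rw [Real.logb_pow]
  norm_num

end Parameters

theorem hasAmortizedUpdateTime [Fintype V] {δ β ε lam : ℝ}
    (h : Parameters (Fintype.card V) δ β ε lam) :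
    HasAmortizedUpdateTime V β ε lam (1280 * (ε⁻¹ * max 1 (Real.logb 2 (β / lam)))) := by
  intro o E us _ _
  obtain ⟨T, hT, hle⟩ := exists_totalUpdateTime_le o β lam h.ε_pos h.ε_le E us
  refine ⟨T, hT, hle.trans (mul_le_mul_of_nonneg_right ?_ (Nat.cast_nonneg _))⟩
  have h₁ := (numLevels_le h.lam_pos h.lam_lt).trans (le_max_right 1 _)
  have h₂ := le_max_left 1 (Real.logb 2 (β / lam))
  have hε : 0 < ε⁻¹ := inv_pos.2 h.ε_pos
  rw [div_eq_mul_inv]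
  nlinarith

end DynSparsify

theorem mainTheorem9 :
    (∃ C : ℝ, 0 < C ∧
      ∀ (V : Type) [Fintype V] [DecidableEq V] (δ β ε lam : ℝ),
        DynSparsify.Parameters (Fintype.card V) δ β ε lam →
          DynSparsify.HasAmortizedUpdateTime V β ε lam
            (C * (ε⁻¹ * max 1 (Real.logb 2 (β / lam))))) ∧
    (∀ δ : ℝ, ∃ C : ℝ, 0 < C ∧
      ∀ (V : Type) [Fintype V] [DecidableEq V] (β ε lam : ℝ),
        DynSparsify.Parameters (Fintype.card V) δ β ε lam →
          DynSparsify.HasAmortizedUpdateTime V β ε lam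
            (C * Real.logb 2 (Fintype.card V) ^ 2)) := by
  refine ⟨⟨1280, by norm_num, fun V _ _ δ β ε lam h => DynSparsify.hasAmortizedUpdateTime h⟩,
    fun δ => ?_⟩
  rcases le_or_gt δ 0 with hδ | hδ
  · exact ⟨1, one_pos, fun V _ _ β ε lam h => absurd h.δ_pos hδ.not_gt⟩
  -- `1280 / ε * max 1 (log (β / lam))` with `1 / ε = 5000 / δ * log n` and `β / lam ≤ n ^ 2`
  refine ⟨12800000 / δ, by positivity, fun V _ _ β ε lam h o E us hE hus => ?_⟩
  obtain ⟨T, hT, hle⟩ := DynSparsify.hasAmortizedUpdateTime h o E us hE hus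
  refine ⟨T, hT, hle.trans (mul_le_mul_of_nonneg_right ?_ (Nat.cast_nonneg _))⟩
  have hlog := h.one_le_logb
  have hε : 0 < ε⁻¹ := inv_pos.2 h.ε_pos
  have hmax : max 1 (Real.logb 2 (β / lam)) ≤ 2 * Real.logb 2 (Fintype.card V) :=
    max_le (by linarith) h.logb_div_le
  have hinv : ε⁻¹ = 5000 / δ * Real.logb 2 (Fintype.card V) := by
    have := h.ε_pos.ne'
    field_simp
    linarith [h.δ_eq_ε]
  calc 1280 * (ε⁻¹ * max 1 (Real.logb 2 (β / lam)))
      ≤ 1280 * (ε⁻¹ * (2 * Real.logb 2 (Fintype.card V))) := by gcongr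
    _ = 12800000 / δ * Real.logb 2 (Fintype.card V) ^ 2 := by rw [hinv]; ring
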